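/- Let $\mathcal A$ be a (not necessarily unital) complex C*-algebra and let $\mathcal B$ be a C*-subalgebra of $\mathcal A$ (a norm-closed $*$-subalgebra). For $A\in\mathcal A$ put $L(A)=\inf\{\|A-B\| : B\in\mathcal B\}$. A seminorm $M$ on $\mathcal A$ is called *Leibniz* if $M(AC)\le M(A)\|C\|+\|A\|M(C)$ for all $A,C\in\mathcal A$. If $\mathcal A$ is unital, $M$ is called *strongly-Leibniz* if it is Leibniz, $M(1_{\mathcal A})=0$, and $M(A^{-1})\le\|A^{-1}\|^2M(A)$ for every invertible $A\in\mathcal A$. (1) Suppose that $\mathcal B$ contains a bounded approximate identity for $\mathcal A$, that is, there is a norm-bounded net $(E_\lambda)$ in $\mathcal B$ with $E_\lambda A\to A$ and $AE_\lambda\to A$ in norm for every $A\in\mathcal A$. Then $L$ is the largest Leibniz seminorm on $\mathcal A$ that takes the value $0$ on $\mathcal B$ and is dominated by the C*-norm: $L$ is itself a Leibniz seminorm with $L(B)=0$ for all $B\in\mathcal B$ and $L(A)\le\|A\|$ for all $A\in\mathcal A$, and every Leibniz seminorm $M$ on $\mathcal A$ with these two properties satisfies $M(A)\le L(A)$ for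 all $A\in\mathcal A$. (2) If $\mathcal A$ is unital and $1_{\mathcal A}\in\mathcal B$, then $L$ is, in the same sense, the largest strongly-Leibniz seminorm on $\mathcal A$ that takes the value $0$ on $\mathcal B$ and is dominated by the C*-norm. -/

import Mathlib

section QuotientSeminorm

variable {A : Type*} [NonUnitalCStarAlgebra A]

/-- `a ↦ inf {‖a - b‖ : b ∈ B}`: the quotient norm of `A / B`, pulled back to a seminorm on `A`. -/
noncomputable def quotientSeminorm (B : NonUnitalStarSubalgebra ℂ A) : Seminorm ℂ A :=
  Seminorm.ofSMulLE (fun a => ⨅ b : B, ‖a - (b : A)‖)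
    (le_antisymm
      ((ciInf_le ⟨0, by rintro _ ⟨b, rfl⟩; exact norm_nonneg _⟩ (0 : B)).trans (by simp))
      (Real.iInf_nonneg fun _ => norm_nonneg _))
    (fun x y => by
      refine le_ciInf_add_ciInf fun b c => ?_
      refine (ciInf_le ⟨0, by rintro _ ⟨b, rfl⟩; exact norm_nonneg _⟩ (b + c)).trans ?_
      have h : x + y - ((b + c : B) : A) = (x - b) + (y - c) := by push_cast; abel
      rw [h]
      exact norm_add_le _ _)
    (fun r x => by
      rw [Real.mul_iInf_of_nonneg (norm_nonneg r)]
      refine le_ciInf fun b => ?_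
      refine (ciInf_le ⟨0, by rintro _ ⟨b, rfl⟩; exact norm_nonneg _⟩ (r • b)).trans ?_
      have h : r • x - ((r • b : B) : A) = r • (x - b) := by push_cast; rw [smul_sub]
      rw [h, norm_smul])

/-- `B` contains a bounded approximate identity for `A`. The approximate identity is given as a
filter; for a net it is the filter of tails. -/
def ContainsBoundedApproximateIdentity (B : NonUnitalStarSubalgebra ℂ A) : Prop :=
  ∃ l : Filter A, l.IsApproximateUnit ∧ ∃ K : ℝ, ∀ᶠ e in l, e ∈ B ∧ ‖e‖ ≤ K

/-- The Leibniz inequality for a seminorm on a C⋆-algebra. -/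
def IsLeibniz (M : Seminorm ℂ A) : Prop :=
  ∀ a c : A, M (a * c) ≤ M a * ‖c‖ + ‖a‖ * M c

end QuotientSeminorm

/-- Strongly-Leibniz seminorms on a unital C⋆-algebra. -/
structure IsStronglyLeibniz {A : Type*} [CStarAlgebra A] (M : Seminorm ℂ A) : Prop where
  leibniz : IsLeibniz M
  map_one : M 1 = 0
  map_inv : ∀ u : Aˣ, M (↑u⁻¹ : A) ≤ ‖(↑u⁻¹ : A)‖ ^ 2 * M (u : A)

/-!
The distance `L a` from `a` to `B` is the value at `a` of a contractive functional `ψ` that vanishes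
on `B`. By Hahn–Banach there is a positive functional `φ` with `|ψ x|² ≤ φ(x⋆x) ≤ ‖x‖²`, so `ψ` has
the form `x ↦ ⟪η, ι x⟫`, where `ι` is the contraction from `A` to the GNS space of `φ`, and `η` is
orthogonal to the closure `V` of `ι(B)`. The reflection `U` in `V` commutes with `π(B)`, where `π`
is the GNS representation, and along a contractive approximate unit `u` of the closure of `B`
`2 |ψ(au)| = |⟪η, (U π(a) - π(a) U) ι u⟫| ≤ ‖U π(a) - π(a) U‖`.
Hence `L` is pointwise an attained maximum of the seminorms `a ↦ ½ ‖U π(a) - π(a) U‖`, which are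
strongly Leibniz because `U π(·) - π(·) U` is a derivation. The maximality of `L` is the triangle
inequality.
-/

open Filter Topology
open scoped ComplexOrder InnerProductSpace ComplexStarModule Pointwise

section Sandwich

variable {E : Type*} [AddCommGroup E] [Module ℝ E]

/-- The epigraph of `x ↦ inf {N (x + h) - t : (h, t) ∈ C}`, up to its boundary: the cone to which
the Riesz extension theorem is applied in the sandwich theorem. -/
def infConvolutionEpigraph (C : PointedCone ℝ (E × ℝ)) (N : E → ℝ)
    (N_smul : ∀ c : ℝ, 0 ≤ c → ∀ x, N (c • x) = c * N x)
    (N_add : ∀ x y, N (x + y) ≤ N x + N y) : PointedCone ℝ (E × ℝ) where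
  carrier := {x | ∃ y ∈ C, N (x.1 + y.1) ≤ x.2 + y.2}
  zero_mem' := ⟨0, C.zero_mem, by simpa using (N_smul 0 le_rfl 0).le⟩
  add_mem' := by
    rintro x x' ⟨y, hy, hxy⟩ ⟨y', hy', hxy'⟩
    refine ⟨y + y', C.add_mem hy hy', ?_⟩
    calc N ((x + x').1 + (y + y').1) = N ((x.1 + y.1) + (x'.1 + y'.1)) := by
          rw [Prod.fst_add, Prod.fst_add, add_add_add_comm]
      _ ≤ (x.2 + y.2) + (x'.2 + y'.2) := (N_add _ _).trans (add_le_add hxy hxy')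
      _ = (x + x').2 + (y + y').2 := add_add_add_comm _ _ _ _
  smul_mem' := by
    rintro c x ⟨y, hy, hxy⟩
    refine ⟨c • y, Submodule.smul_mem C c hy, ?_⟩
    calc N ((c • x).1 + (c • y).1) = c * N (x.1 + y.1) := by
          rw [← N_smul c c.2, smul_add]; rfl
      _ ≤ c * (x.2 + y.2) := mul_le_mul_of_nonneg_left hxy c.2
      _ = (c • x).2 + (c • y).2 := mul_add _ _ _

/-- The sandwich form of the Hahn–Banach theorem: `C` is the hypograph of a superlinear function. -/
theorem exists_linearMap_between_pointedCone_sublinear (C : PointedCone ℝ (E × ℝ)) (N : E → ℝ)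
    (N_smul : ∀ c : ℝ, 0 ≤ c → ∀ x, N (c • x) = c * N x)
    (N_add : ∀ x y, N (x + y) ≤ N x + N y) (hCN : ∀ x ∈ C, x.2 ≤ N x.1) :
    ∃ g : E →ₗ[ℝ] ℝ, (∀ x ∈ C, x.2 ≤ g x.1) ∧ ∀ x, g x ≤ N x := by
  let S := infConvolutionEpigraph C N N_smul N_add
  let f : (E × ℝ) →ₗ.[ℝ] ℝ :=
    ⟨(⊥ : Submodule ℝ E).prod ⊤, LinearMap.snd ℝ E ℝ ∘ₗ Submodule.subtype _⟩
  have f_nonneg : ∀ x : f.domain, (x : E × ℝ) ∈ S → 0 ≤ f x := by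
    rintro ⟨⟨x, r⟩, hx, _⟩ ⟨y, hy, hxy⟩
    obtain rfl : x = 0 := hx
    have h : y.2 ≤ r + y.2 := (hCN y hy).trans (by simpa using hxy)
    exact nonneg_of_le_add_left h
  have f_cofinal (y : E × ℝ) : ∃ x : f.domain, (x : E × ℝ) + y ∈ S :=
    ⟨⟨(0, N y.1 - y.2), rfl, trivial⟩, 0, C.zero_mem, by simp⟩
  obtain ⟨g, hgf, hgS⟩ := riesz_extension S f f_nonneg f_cofinal
  have hg (x : E) (r : ℝ) : g (x, r) = g (x, 0) + r := by
    have h : g (0, r) = r := hgf ⟨(0, r), rfl, trivial⟩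
    simpa [h] using g.map_add (x, 0) (0, r)
  refine ⟨-(g ∘ₗ LinearMap.inl ℝ E ℝ), fun x hx ↦ ?_, fun x ↦ ?_⟩
  · have h := hgS (-x) ⟨x, hx, by simpa using (N_smul 0 le_rfl 0).le⟩
    rw [map_neg, neg_nonneg, hg] at h
    exact le_neg_iff_add_nonpos_left.2 h
  · have h := hgS (x, N x) ⟨0, C.zero_mem, by simp⟩
    rw [hg] at h
    exact neg_le_iff_add_nonneg'.2 h

end Sandwich

lemma exists_dual_vector_infDist {𝕜 E : Type*} [RCLike 𝕜] [NormedAddCommGroup E]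
    [NormedSpace 𝕜 E] (V : Submodule 𝕜 E) (a : E) :
    ∃ ψ : StrongDual 𝕜 E, ‖ψ‖ ≤ 1 ∧ (∀ v ∈ V, ψ v = 0) ∧ ψ a = (Metric.infDist a V : ℝ) := by
  obtain ⟨g, hg, hga⟩ := exists_dual_vector'' 𝕜 (V.mkQL a)
  refine ⟨g ∘L V.mkQL, ContinuousLinearMap.opNorm_le_bound _ zero_le_one fun x ↦ ?_,
    fun v hv ↦ ?_, ?_⟩
  · exact (g.le_of_opNorm_le hg _).trans (by gcongr; exact Submodule.Quotient.norm_mk_le V x)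
  · have h : V.mkQL v = 0 := (Submodule.Quotient.mk_eq_zero V).2 hv
    simp [h]
  · rw [ContinuousLinearMap.comp_apply, hga]
    exact congrArg _ (QuotientAddGroup.norm_mk (S := V.toAddSubgroup) a)

section Domination

variable {A : Type*} [NonUnitalCStarAlgebra A] [PartialOrder A] [StarOrderedRing A]

lemma star_mul_self_smul_add_smul_le (p q : ℂ) (c d : A) :
    star (p • c + q • d) * (p • c + q • d) ≤
      (‖p‖ ^ 2 + ‖q‖ ^ 2) • (star c * c + star d * d) := by
  have h : (‖p‖ ^ 2 + ‖q‖ ^ 2) • (star c * c + star d * d) =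
      star (p • c + q • d) * (p • c + q • d) +
        star (star q • c - star p • d) * (star q • c - star p • d) := by
    have hpq : ((‖p‖ ^ 2 + ‖q‖ ^ 2 : ℝ) : ℂ) = star p * p + star q * q := by
      simpa using congrArg₂ (· + ·) (Complex.conj_mul' p).symm (Complex.conj_mul' q).symm
    rw [← Complex.coe_smul, hpq]
    simp only [star_add, star_sub, star_smul, star_star, add_mul, mul_add, sub_mul, mul_sub,
      smul_mul_assoc, mul_smul_comm]
    module
  rw [h]
  exact le_add_of_nonneg_right (star_mul_self_nonneg _)

lemma exists_star_mul_self_le_and_norm_sq_eq (ψ : A →ₗ[ℂ] ℂ) (c d : A) :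
    ∃ x : A, star x * x ≤ star c * c + star d * d ∧ ‖ψ x‖ ^ 2 = ‖ψ c‖ ^ 2 + ‖ψ d‖ ^ 2 := by
  set s : ℝ := ‖ψ c‖ ^ 2 + ‖ψ d‖ ^ 2 with hs
  obtain hs0 | hs0 : 0 = s ∨ 0 < s := (by positivity : 0 ≤ s).eq_or_lt
  · exact ⟨0, by simpa using add_nonneg (star_mul_self_nonneg c) (star_mul_self_nonneg d),
      by simp [← hs0]⟩
  set y : A := star (ψ c) • c + star (ψ d) • d
  have hy : star y * y ≤ s • (star c * c + star d * d) := by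
    simpa only [norm_star] using star_mul_self_smul_add_smul_le (star (ψ c)) (star (ψ d)) c d
  have hψy : ψ y = s := by
    simp [y, hs, Complex.conj_mul']
  have hsq : (√s)⁻¹ * (√s)⁻¹ = s⁻¹ := by rw [← mul_inv, Real.mul_self_sqrt hs0.le]
  refine ⟨(√s)⁻¹ • y, ?_, ?_⟩
  · calc star ((√s)⁻¹ • y) * ((√s)⁻¹ • y) = s⁻¹ • (star y * y) := by
          rw [star_smul, star_trivial, smul_mul_smul_comm, hsq]
      _ ≤ s⁻¹ • s • (star c * c + star d * d) := by gcongr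
      _ = star c * c + star d * d := inv_smul_smul₀ hs0.ne' _
  · rw [← Complex.coe_smul, map_smul, hψy, smul_eq_mul, norm_mul, mul_pow]
    simp only [Complex.norm_real, norm_inv, inv_pow, Real.norm_eq_abs, sq_abs, Real.sq_sqrt hs0.le]
    field_simp

/-- The hypograph of `h ↦ sup {‖ψ a‖² : a⋆a ≤ h}`, a superlinear function on the positive cone of
`A`. A linear functional lies above it exactly when it is positive and its value at `a⋆a` dominates
`‖ψ a‖²` for all `a`. -/
def squareHypograph (ψ : A →ₗ[ℂ] ℂ) : PointedCone ℝ (A × ℝ) where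
  carrier := {x | ∃ a, star a * a ≤ x.1 ∧ x.2 ≤ ‖ψ a‖ ^ 2}
  zero_mem' := ⟨0, by simp⟩
  add_mem' := by
    rintro x y ⟨a, hax, hxa⟩ ⟨b, hby, hyb⟩
    obtain ⟨c, hc, hψc⟩ := exists_star_mul_self_le_and_norm_sq_eq ψ a b
    exact ⟨c, hc.trans (add_le_add hax hby), (add_le_add hxa hyb).trans_eq hψc.symm⟩
  smul_mem' := by
    rintro ⟨r, hr⟩ x ⟨a, hax, hxa⟩
    refine ⟨√r • a, ?_, ?_⟩
    · rw [star_smul, star_trivial, smul_mul_smul_comm, Real.mul_self_sqrt hr]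
      exact smul_le_smul_of_nonneg_left hax hr
    · rw [← Complex.coe_smul, map_smul, norm_smul, mul_pow, Complex.norm_real, Real.norm_eq_abs,
        sq_abs, Real.sq_sqrt hr]
      exact mul_le_mul_of_nonneg_left hxa hr

lemma exists_positiveLinearMap_apply_eq_of_isSelfAdjoint (g : A →ₗ[ℝ] ℝ)
    (hg : ∀ x, 0 ≤ x → 0 ≤ g x) : ∃ φ : A →ₚ[ℂ] ℂ, ∀ x, IsSelfAdjoint x → φ x = g x := by
  let f : A →ₗ[ℂ] ℂ :=
    Module.Dual.extendRCLike (g ∘ₗ (selfAdjoint.submodule ℝ A).subtype ∘ₗ realPart)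
  have hf (x : A) (hx : IsSelfAdjoint x) : f x = g x := by
    have h : f x = g (ℜ x) - Complex.I * g (ℜ (Complex.I • x)) := rfl
    simp [h, hx.coe_realPart, hx.imaginaryPart, realPart_I_smul]
  refine ⟨.mk₀ f fun x hx ↦ ?_, hf⟩
  rw [hf x (.of_nonneg hx)]
  exact_mod_cast hg x hx

theorem exists_positiveLinearMap_norm_sq_le (ψ : StrongDual ℂ A) (hψ : ‖ψ‖ ≤ 1) :
    ∃ φ : A →ₚ[ℂ] ℂ, ∀ a,
      ‖ψ a‖ ^ 2 ≤ (φ (star a * a)).re ∧ (φ (star a * a)).re ≤ ‖a‖ ^ 2 := by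
  have h_norm : ∀ x ∈ squareHypograph (ψ : A →ₗ[ℂ] ℂ), x.2 ≤ ‖x.1‖ := by
    rintro x ⟨a, hax, hxa⟩
    calc x.2 ≤ ‖ψ a‖ ^ 2 := hxa
      _ ≤ ‖a‖ ^ 2 := by gcongr; simpa using ψ.le_of_opNorm_le hψ a
      _ = ‖star a * a‖ := by rw [CStarRing.norm_star_mul_self, sq]
      _ ≤ ‖x.1‖ := CStarAlgebra.norm_le_norm_of_nonneg_of_le (star_mul_self_nonneg a) hax
  obtain ⟨g, hψg, hg⟩ := exists_linearMap_between_pointedCone_sublinear _ (‖·‖)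
    (fun c hc x ↦ by rw [norm_smul, Real.norm_of_nonneg hc]) norm_add_le h_norm
  obtain ⟨φ, hφ⟩ := exists_positiveLinearMap_apply_eq_of_isSelfAdjoint g fun x hx ↦
    hψg (x, 0) ⟨0, by simpa using hx, by simp⟩
  refine ⟨φ, fun a ↦ ?_⟩
  rw [hφ _ (.star_mul_self a), Complex.ofReal_re]
  exact ⟨hψg (star a * a, ‖ψ a‖ ^ 2) ⟨a, le_rfl, le_rfl⟩,
    (hg _).trans_eq (by rw [CStarRing.norm_star_mul_self, sq])⟩

end Domination

section Representation

lemma exists_norm_le_one_inner_eq {𝕜 E H : Type*} [RCLike 𝕜] [AddCommGroup E] [Module 𝕜 E]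
    [NormedAddCommGroup H] [InnerProductSpace 𝕜 H] [CompleteSpace H] (ι : E →ₗ[𝕜] H)
    (ψ : E →ₗ[𝕜] 𝕜) (h : ∀ x, ‖ψ x‖ ≤ ‖ι x‖) :
    ∃ η : H, ‖η‖ ≤ 1 ∧ ∀ x, ⟪η, ι x⟫_𝕜 = ψ x := by
  obtain ⟨f, hf⟩ : ψ ∈ ι.dualMap.range := by
    rw [LinearMap.range_dualMap_eq_dualAnnihilator_ker, Submodule.mem_dualAnnihilator]
    exact fun x hx ↦ norm_le_zero_iff.1 ((h x).trans_eq (by rw [LinearMap.mem_ker.1 hx, norm_zero]))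
  have hfι (x : E) : f (ι x) = ψ x := LinearMap.congr_fun hf x
  let g : StrongDual 𝕜 ι.range := (f.domRestrict ι.range).mkContinuous 1 <| by
    rintro ⟨_, x, rfl⟩
    simpa [hfι] using h x
  obtain ⟨F, hFg, hF⟩ := exists_extension_norm_eq ι.range g
  refine ⟨(InnerProductSpace.toDual 𝕜 H).symm F, ?_, fun x ↦ ?_⟩
  · rw [LinearIsometryEquiv.norm_map, hF]
    exact LinearMap.mkContinuous_norm_le _ zero_le_one _
  · rw [InnerProductSpace.toDual_symm_apply]
    exact (hFg ⟨ι x, x, rfl⟩).trans (hfι x)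

/-- The GNS representation of a positive functional that dominates `ψ`; no cyclic vector is
available without a unit, and `ι` takes its place. -/
theorem exists_representation_inner_eq.{u} {A : Type u} [NonUnitalCStarAlgebra A]
    (ψ : StrongDual ℂ A) (hψ : ‖ψ‖ ≤ 1) :
    ∃ (H : Type u) (_ : NormedAddCommGroup H) (_ : InnerProductSpace ℂ H) (_ : CompleteSpace H)
      (π : A →⋆ₙₐ[ℂ] (H →L[ℂ] H)) (ι : A →L[ℂ] H) (η : H), ‖ι‖ ≤ 1 ∧ ‖η‖ ≤ 1 ∧
        (∀ a b, π a (ι b) = ι (a * b)) ∧ ∀ a, ⟪η, ι a⟫_ℂ = ψ a := by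
  let _ := CStarAlgebra.spectralOrder A
  let _ := CStarAlgebra.spectralOrderedRing A
  obtain ⟨φ, hφ⟩ := exists_positiveLinearMap_norm_sq_le ψ hψ
  let ι : A →ₗ[ℂ] φ.GNS :=
    (UniformSpace.Completion.toComplL (𝕜 := ℂ) (E := φ.PreGNS)).toLinearMap ∘ₗ
      φ.toPreGNS.toLinearMap
  have hι (a : A) : ‖ι a‖ = √(φ (star a * a)).re :=
    (UniformSpace.Completion.norm_coe _).trans (φ.preGNS_norm_def _)
  obtain ⟨η, hη, hηψ⟩ := exists_norm_le_one_inner_eq ι ψ fun a ↦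
    (Real.le_sqrt_of_sq_le (hφ a).1).trans_eq (hι a).symm
  have hι_le (a : A) : ‖ι a‖ ≤ 1 * ‖a‖ := by
    rw [hι, one_mul]
    exact Real.sqrt_le_iff.2 ⟨norm_nonneg a, (hφ a).2⟩
  exact ⟨φ.GNS, inferInstance, inferInstance, inferInstance, φ.gnsNonUnitalStarAlgHom,
    ι.mkContinuous 1 hι_le, η, ι.mkContinuous_norm_le zero_le_one hι_le, hη,
    fun _ _ ↦ φ.gnsNonUnitalStarAlgHom_apply_coe, hηψ⟩

end Representation

section Reflection

variable {𝕜 H : Type*} [RCLike 𝕜] [NormedAddCommGroup H] [InnerProductSpace 𝕜 H]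
  (V : Submodule 𝕜 H) [V.HasOrthogonalProjection]

/-- The reflection in `V`, as an element of the algebra of bounded operators, where commutators
with it are taken. -/
noncomputable def reflectionOperator : H →L[𝕜] H :=
  V.reflection.toLinearIsometry.toContinuousLinearMap

lemma norm_reflectionOperator_le : ‖reflectionOperator V‖ ≤ 1 :=
  LinearIsometry.norm_toContinuousLinearMap_le _

lemma reflectionOperator_eq : reflectionOperator V = 2 • V.starProjection - 1 :=
  ContinuousLinearMap.ext fun x ↦ V.reflection_apply x

lemma commute_reflectionOperator [CompleteSpace H] {T : H →L[𝕜] H}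
    (hT : ∀ v ∈ V, T v ∈ V) (hT_star : ∀ v ∈ V, star T v ∈ V) :
    Commute (reflectionOperator V) T := by
  have h : Commute V.starProjection T := by
    rw [ContinuousLinearMap.IsIdempotentElem.commute_iff V.isIdempotentElem_starProjection,
      V.range_starProjection, V.ker_starProjection]
    exact ⟨hT, ContinuousLinearMap.orthogonal_mem_invtSubmodule hT_star⟩
  rw [reflectionOperator_eq]
  exact (h.smul_left 2).sub_left (Commute.one_left T)

lemma two_mul_norm_inner_le_norm_commutator (T : H →L[𝕜] H) {v η : H} (hv : v ∈ V)
    (hη : η ∈ Vᗮ) :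
    2 * ‖⟪η, T v⟫_𝕜‖ ≤
      ‖η‖ * (‖reflectionOperator V * T - T * reflectionOperator V‖ * ‖v‖) := by
  have hηV (x : H) : ⟪η, V.reflection x⟫_𝕜 = -⟪η, x⟫_𝕜 := by
    rw [← V.reflection.inner_map_map,
      V.reflection_mem_subspace_orthogonalComplement_eq_neg hη, V.reflection_reflection,
      inner_neg_left]
  have h : ⟪η, (reflectionOperator V * T - T * reflectionOperator V) v⟫_𝕜 = -(2 * ⟪η, T v⟫_𝕜) :=
    calc ⟪η, V.reflection (T v) - T (V.reflection v)⟫_𝕜 = -⟪η, T v⟫_𝕜 - ⟪η, T v⟫_𝕜 := by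
          rw [V.reflection_mem_subspace_eq_self hv, inner_sub_right, hηV]
      _ = -(2 * ⟪η, T v⟫_𝕜) := by ring
  calc 2 * ‖⟪η, T v⟫_𝕜‖
      = ‖⟪η, (reflectionOperator V * T - T * reflectionOperator V) v⟫_𝕜‖ := by
        rw [h, norm_neg, norm_mul, RCLike.norm_ofNat]
    _ ≤ _ := norm_inner_le_norm _ _
    _ ≤ _ := by gcongr; exact ContinuousLinearMap.le_opNorm _ _

end Reflection

section CommutatorSeminorm

open scoped NNReal

/-- The seminorm `a ↦ ½ ‖U π(a) - π(a) U‖` of the derivation implemented by `U`; the factor `½`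
makes it contractive when `U` is. -/
noncomputable def commutatorSeminorm {A D : Type*} [NonUnitalCStarAlgebra A]
    [NonUnitalCStarAlgebra D] (π : A →⋆ₙₐ[ℂ] D) (U : D) : Seminorm ℂ A :=
  (2⁻¹ : ℝ≥0) • (normSeminorm ℂ D).comp
    ((LinearMap.mulLeft ℂ U - LinearMap.mulRight ℂ U) ∘ₗ (π : A →ₗ[ℂ] D))

variable {A D : Type*} [NonUnitalCStarAlgebra D]

section NonUnital

variable [NonUnitalCStarAlgebra A] (π : A →⋆ₙₐ[ℂ] D) {U : D}

lemma commutatorSeminorm_apply (U : D) (a : A) :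
    commutatorSeminorm π U a = 2⁻¹ * ‖U * π a - π a * U‖ := rfl

variable {π} in
lemma commutatorSeminorm_eq_zero_iff {a : A} :
    commutatorSeminorm π U a = 0 ↔ Commute U (π a) := by
  simp [commutatorSeminorm_apply, sub_eq_zero, commute_iff_eq]

lemma commutatorSeminorm_le_norm (hU : ‖U‖ ≤ 1) (a : A) : commutatorSeminorm π U a ≤ ‖a‖ := by
  have h : ‖U * π a - π a * U‖ ≤ ‖π a‖ + ‖π a‖ :=
    norm_sub_le_of_le (norm_mul_le_of_le hU le_rfl |>.trans_eq (one_mul _))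
      (norm_mul_le_of_le le_rfl hU |>.trans_eq (mul_one _))
  rw [commutatorSeminorm_apply]
  linarith [NonUnitalStarAlgHom.norm_apply_le π a]

lemma isLeibniz_commutatorSeminorm (U : D) : IsLeibniz (commutatorSeminorm π U) := by
  intro a c
  have derivation : U * π (a * c) - π (a * c) * U =
      (U * π a - π a * U) * π c + π a * (U * π c - π c * U) := by
    simp only [map_mul, sub_mul, mul_sub, mul_assoc]
    abel
  calc commutatorSeminorm π U (a * c)
      = 2⁻¹ * ‖(U * π a - π a * U) * π c + π a * (U * π c - π c * U)‖ := by
        rw [commutatorSeminorm_apply, derivation]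
    _ ≤ 2⁻¹ * (‖U * π a - π a * U‖ * ‖c‖ + ‖a‖ * ‖U * π c - π c * U‖) := by
        gcongr
        exact norm_add_le_of_le
          (norm_mul_le_of_le le_rfl (NonUnitalStarAlgHom.norm_apply_le π c))
          (norm_mul_le_of_le (NonUnitalStarAlgHom.norm_apply_le π a) le_rfl)
    _ = commutatorSeminorm π U a * ‖c‖ + ‖a‖ * commutatorSeminorm π U c := by
        simp only [commutatorSeminorm_apply]
        ring

end NonUnital

lemma isStronglyLeibniz_commutatorSeminorm [CStarAlgebra A] (π : A →⋆ₙₐ[ℂ] D) {U : D}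
    (h : Commute U (π 1)) : IsStronglyLeibniz (commutatorSeminorm π U) where
  leibniz := isLeibniz_commutatorSeminorm π U
  map_one := commutatorSeminorm_eq_zero_iff.2 h
  map_inv u := by
    set v : A := ↑u⁻¹
    have derivation_inv : U * π v - π v * U = -(π v * (U * π u - π u * U) * π v) := by
      have hleft : π v * (U * π u) * π v = π v * U := by
        rw [mul_assoc, mul_assoc, ← map_mul, u.mul_inv, h.eq, ← mul_assoc, ← map_mul, mul_one]
      have hright : π v * (π u * U) * π v = U * π v := by
        rw [← mul_assoc, ← map_mul, u.inv_mul, ← h.eq, mul_assoc, ← map_mul, one_mul]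
      rw [mul_sub, sub_mul, hleft, hright, neg_sub]
    calc commutatorSeminorm π U v = 2⁻¹ * ‖π v * (U * π u - π u * U) * π v‖ := by
          rw [commutatorSeminorm_apply, derivation_inv, norm_neg]
      _ ≤ 2⁻¹ * (‖v‖ * ‖U * π u - π u * U‖ * ‖v‖) := by
          gcongr
          have hv := NonUnitalStarAlgHom.norm_apply_le π v
          exact norm_mul_le_of_le (norm_mul_le_of_le hv le_rfl) hv
      _ = ‖v‖ ^ 2 * commutatorSeminorm π U u := by
          rw [commutatorSeminorm_apply]
          ring

end CommutatorSeminorm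

section QuotientSeminorm

variable {A : Type*} [NonUnitalCStarAlgebra A] {B : NonUnitalStarSubalgebra ℂ A}

lemma quotientSeminorm_eq_infDist (a : A) :
    quotientSeminorm B a = Metric.infDist a (B : Set A) := by
  simp only [Metric.infDist_eq_iInf, dist_eq_norm]
  rfl

lemma quotientSeminorm_le_norm (a : A) : quotientSeminorm B a ≤ ‖a‖ := by
  rw [quotientSeminorm_eq_infDist, ← dist_zero_right]
  exact Metric.infDist_le_dist_of_mem B.zero_mem

lemma quotientSeminorm_eq_zero_of_mem_closure {b : A} (hb : b ∈ closure (B : Set A)) :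
    quotientSeminorm B b = 0 := by
  rw [quotientSeminorm_eq_infDist, Metric.infDist_zero_of_mem_closure hb]

theorem le_quotientSeminorm {M : Seminorm ℂ A} (hMB : ∀ b ∈ B, M b = 0) (hM : ∀ a, M a ≤ ‖a‖) :
    M ≤ quotientSeminorm B := fun a ↦ by
  rw [quotientSeminorm_eq_infDist]
  refine (Metric.le_infDist ⟨0, B.zero_mem⟩).2 fun b hb ↦ ?_
  calc M a = M (a - b + b) := by rw [sub_add_cancel]
    _ ≤ M (a - b) + M b := map_add_le_add M _ _
    _ ≤ dist a b := by rw [hMB b hb, add_zero, dist_eq_norm]; exact hM _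

end QuotientSeminorm

section ApproximateUnit

variable {A : Type*} [NonUnitalCStarAlgebra A]

/-- `B` acts nondegenerately on `A` by multiplication: the products `a * b` with `b ∈ B` span a
dense subspace of `A`. For closed `B` this means that `B` contains an approximate
identity for `A`. -/
def IsNondegenerate (B : NonUnitalStarSubalgebra ℂ A) : Prop :=
  Dense (Submodule.span ℂ (Set.univ * (B : Set A)) : Set A)

lemma ContainsBoundedApproximateIdentity.isNondegenerate {B : NonUnitalStarSubalgebra ℂ A}
    (h : ContainsBoundedApproximateIdentity B) : IsNondegenerate B := by
  obtain ⟨l, hl, K, hK⟩ := h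
  have := hl.neBot
  exact fun a ↦ mem_closure_of_tendsto (hl.tendsto_mul_left a) <| hK.mono fun e he ↦
    Submodule.subset_span (Set.mul_mem_mul (Set.mem_univ a) he.1)

lemma isNondegenerate_of_one_mem {A : Type*} [CStarAlgebra A] {B : NonUnitalStarSubalgebra ℂ A}
    (h : 1 ∈ B) : IsNondegenerate B := fun a ↦
  subset_closure <| Submodule.subset_span ⟨a, Set.mem_univ a, 1, h, mul_one a⟩

lemma tendsto_mul_of_mem_closure {R : Type*} [NonUnitalSeminormedRing R] {l : Filter R} {S : Set R}
    (hl : ∀ᶠ u in l, ‖u‖ ≤ 1) (hS : ∀ s ∈ S, Tendsto (s * ·) l (𝓝 s)) {a : R}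
    (ha : a ∈ closure S) : Tendsto (a * ·) l (𝓝 a) := by
  rw [Metric.tendsto_nhds]
  intro ε hε
  obtain ⟨s, hs, has⟩ := Metric.mem_closure_iff.1 ha (ε / 3) (by positivity)
  filter_upwards [hl, Metric.tendsto_nhds.1 (hS s hs) (ε / 3) (by positivity)] with u hu hsu
  have hasu : dist (a * u) (s * u) ≤ dist a s := by
    simp only [dist_eq_norm]
    rw [← sub_mul]
    exact (norm_mul_le_of_le le_rfl hu).trans_eq (mul_one _)
  linarith [dist_triangle4 (a * u) (s * u) s a, dist_comm a s]

theorem IsNondegenerate.exists_approximateUnit {B : NonUnitalStarSubalgebra ℂ A}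
    (hB : IsNondegenerate B) :
    ∃ l : Filter A, l.NeBot ∧ (∀ᶠ u in l, u ∈ closure (B : Set A) ∧ ‖u‖ ≤ 1) ∧
      ∀ a, Tendsto (a * ·) l (𝓝 a) := by
  let C := B.topologicalClosure
  have : IsClosed (C : Set A) := B.isClosed_topologicalClosure
  let _ := CStarAlgebra.spectralOrder C
  let _ := CStarAlgebra.spectralOrderedRing C
  have hC := CStarAlgebra.increasingApproximateUnit C
  have := hC.neBot
  let l : Filter A := (CStarAlgebra.approximateUnit C).map Subtype.val
  have h_mem : ∀ᶠ u in l, u ∈ closure (B : Set A) ∧ ‖u‖ ≤ 1 :=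
    eventually_map.2 <| hC.eventually_norm.mono fun u hu ↦ ⟨u.2, hu⟩
  refine ⟨l, inferInstance, h_mem, fun a ↦
    tendsto_mul_of_mem_closure (h_mem.mono fun u hu ↦ hu.2) (fun s hs ↦ ?_) (hB a)⟩
  induction hs using Submodule.span_induction with
  | mem _ hx =>
    obtain ⟨c, -, b, hb, rfl⟩ := hx
    have hb_lim : Tendsto (b * ·) l (𝓝 b) := tendsto_map'_iff.2 <|
      (continuous_subtype_val.tendsto _).comp
        (hC.tendsto_mul_left ⟨b, B.le_topologicalClosure hb⟩)
    simpa only [mul_assoc] using hb_lim.const_mul c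
  | zero => simpa only [zero_mul] using tendsto_const_nhds
  | add x y _ _ hx hy => simpa only [add_mul] using hx.add hy
  | smul z x _ hx => simpa only [smul_mul_assoc] using hx.const_smul z

lemma IsNondegenerate.one_mem_closure {A : Type*} [CStarAlgebra A]
    {B : NonUnitalStarSubalgebra ℂ A} (hB : IsNondegenerate B) : 1 ∈ closure (B : Set A) := by
  obtain ⟨l, _, hl, hl_lim⟩ := hB.exists_approximateUnit
  have h := hl_lim 1
  simp only [one_mul] at h
  rw [← closure_closure]
  exact mem_closure_of_tendsto h (hl.mono fun _ hu ↦ hu.1)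

end ApproximateUnit

section Attainment

lemma commutatorSeminorm_le_quotientSeminorm {A D : Type*} [NonUnitalCStarAlgebra A]
    [NonUnitalCStarAlgebra D] {B : NonUnitalStarSubalgebra ℂ A} {π : A →⋆ₙₐ[ℂ] D} {U : D}
    (hU : ‖U‖ ≤ 1) (hUB : ∀ b ∈ B, Commute U (π b)) :
    commutatorSeminorm π U ≤ quotientSeminorm B :=
  le_quotientSeminorm (fun b hb ↦ commutatorSeminorm_eq_zero_iff.2 (hUB b hb))
    (commutatorSeminorm_le_norm π hU)

lemma isLeibniz_of_forall_exists {A : Type*} [NonUnitalCStarAlgebra A] {L : Seminorm ℂ A}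
    (h : ∀ a, ∃ M : Seminorm ℂ A, IsLeibniz M ∧ M ≤ L ∧ M a = L a) : IsLeibniz L := by
  intro a c
  obtain ⟨M, hM, hML, hac⟩ := h (a * c)
  calc L (a * c) = M (a * c) := hac.symm
    _ ≤ M a * ‖c‖ + ‖a‖ * M c := hM a c
    _ ≤ L a * ‖c‖ + ‖a‖ * L c := by gcongr <;> exact hML _

lemma isStronglyLeibniz_of_forall_exists {A : Type*} [CStarAlgebra A] {L : Seminorm ℂ A}
    (h : ∀ a, ∃ M : Seminorm ℂ A, IsStronglyLeibniz M ∧ M ≤ L ∧ M a = L a) :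
    IsStronglyLeibniz L where
  leibniz := isLeibniz_of_forall_exists fun a ↦ (h a).imp fun _ hM ↦ ⟨hM.1.leibniz, hM.2⟩
  map_one := by
    obtain ⟨M, hM, -, h1⟩ := h 1
    exact h1.symm.trans hM.map_one
  map_inv u := by
    obtain ⟨M, hM, hML, hu⟩ := h ↑u⁻¹
    calc L ↑u⁻¹ = M ↑u⁻¹ := hu.symm
      _ ≤ ‖(↑u⁻¹ : A)‖ ^ 2 * M u := hM.map_inv u
      _ ≤ ‖(↑u⁻¹ : A)‖ ^ 2 * L u := by gcongr; exact hML _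

end Attainment

section Main

/-- The closure of `ι(B)`: the essential subspace of `B` in the representation given by `ι`. -/
abbrev closedImage {A H : Type*} [NonUnitalCStarAlgebra A] [NormedAddCommGroup H]
    [NormedSpace ℂ H] (ι : A →L[ℂ] H) (B : NonUnitalStarSubalgebra ℂ A) : Submodule ℂ H :=
  (B.toNonUnitalSubalgebra.toSubmodule.map (ι : A →ₗ[ℂ] H)).topologicalClosure

section ClosedImage

variable {A H : Type*} [NonUnitalCStarAlgebra A] {B : NonUnitalStarSubalgebra ℂ A}
  [NormedAddCommGroup H] [InnerProductSpace ℂ H] [CompleteSpace H]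
  {π : A →⋆ₙₐ[ℂ] (H →L[ℂ] H)} {ι : A →L[ℂ] H} {η : H}

lemma commute_reflectionOperator_closedImage (hπι : ∀ a b, π a (ι b) = ι (a * b)) {b : A}
    (hb : b ∈ B) : Commute (reflectionOperator (closedImage ι B)) (π b) := by
  have h_inv : ∀ b ∈ B, ∀ v ∈ closedImage ι B, π b v ∈ closedImage ι B := by
    intro b hb v hv
    refine map_mem_closure (π b).continuous hv ?_
    rintro _ ⟨c, hc, rfl⟩
    exact ⟨b * c, B.mul_mem hb hc, (hπι b c).symm⟩
  exact commute_reflectionOperator _ (h_inv b hb) (map_star π b ▸ h_inv _ (star_mem hb))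

lemma norm_inner_le_commutatorSeminorm (hπι : ∀ a b, π a (ι b) = ι (a * b)) (hι : ‖ι‖ ≤ 1)
    (hη : ‖η‖ ≤ 1) (hηB : ∀ b ∈ B, ⟪η, ι b⟫_ℂ = 0) {u : A} (hu : u ∈ closure (B : Set A))
    (hu_norm : ‖u‖ ≤ 1) (a : A) :
    ‖⟪η, ι (a * u)⟫_ℂ‖ ≤ commutatorSeminorm π (reflectionOperator (closedImage ι B)) a := by
  have hιu : ι u ∈ closedImage ι B :=
    map_mem_closure ι.continuous hu fun b hb ↦ ⟨b, hb, rfl⟩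
  have hη_orth : η ∈ (closedImage ι B)ᗮ := by
    rw [Submodule.orthogonal_closure, Submodule.mem_orthogonal']
    rintro _ ⟨b, hb, rfl⟩
    exact hηB b hb
  rw [commutatorSeminorm_apply, le_inv_mul_iff₀ two_pos, ← hπι]
  set T := reflectionOperator (closedImage ι B) * π a - π a * reflectionOperator (closedImage ι B)
  calc 2 * ‖⟪η, π a (ι u)⟫_ℂ‖ ≤ ‖η‖ * (‖T‖ * ‖ι u‖) :=
        two_mul_norm_inner_le_norm_commutator _ (π a) hιu hη_orth
    _ ≤ 1 * (‖T‖ * (1 * 1)) := by gcongr; exact ι.le_of_opNorm_le_of_le hι hu_norm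
    _ = ‖T‖ := by ring

end ClosedImage

theorem exists_commutatorSeminorm_eq_quotientSeminorm.{u} {A : Type u} [NonUnitalCStarAlgebra A]
    {B : NonUnitalStarSubalgebra ℂ A} (hB : IsNondegenerate B) (a : A) :
    ∃ (D : Type u) (_ : CStarAlgebra D) (π : A →⋆ₙₐ[ℂ] D) (U : D), ‖U‖ ≤ 1 ∧
      (∀ b ∈ B, Commute U (π b)) ∧ commutatorSeminorm π U a = quotientSeminorm B a := by
  obtain ⟨ψ, hψ, hψB, hψa⟩ :=
    exists_dual_vector_infDist B.toNonUnitalSubalgebra.toSubmodule a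
  obtain ⟨H, _, _, _, π, ι, η, hι, hη, hπι, hηψ⟩ := exists_representation_inner_eq ψ hψ
  obtain ⟨l, _, hl, hl_lim⟩ := hB.exists_approximateUnit
  have hU := norm_reflectionOperator_le (closedImage ι B)
  have hUB : ∀ b ∈ B, Commute (reflectionOperator (closedImage ι B)) (π b) := fun b hb ↦
    commute_reflectionOperator_closedImage hπι hb
  refine ⟨H →L[ℂ] H, inferInstance, π, _, hU, hUB,
    (commutatorSeminorm_le_quotientSeminorm hU hUB a).antisymm ?_⟩
  have h_norm : ‖ψ a‖ = quotientSeminorm B a := by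
    rw [hψa, RCLike.norm_ofReal, abs_of_nonneg Metric.infDist_nonneg, quotientSeminorm_eq_infDist]
    rfl
  rw [← h_norm]
  refine le_of_tendsto ((ψ.continuous.tendsto a).comp (hl_lim a)).norm (hl.mono fun u hu ↦ ?_)
  rw [Function.comp_apply, ← hηψ]
  exact norm_inner_le_commutatorSeminorm hπι hι hη (fun b hb ↦ (hηψ b).trans (hψB b hb))
    hu.1 hu.2 a

theorem isLeibniz_quotientSeminorm {A : Type*} [NonUnitalCStarAlgebra A]
    {B : NonUnitalStarSubalgebra ℂ A} (hB : IsNondegenerate B) :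
    IsLeibniz (quotientSeminorm B) :=
  isLeibniz_of_forall_exists fun a ↦ by
    obtain ⟨D, _, π, U, hU, hUB, ha⟩ := exists_commutatorSeminorm_eq_quotientSeminorm hB a
    exact ⟨commutatorSeminorm π U, isLeibniz_commutatorSeminorm π U,
      commutatorSeminorm_le_quotientSeminorm hU hUB, ha⟩

theorem isStronglyLeibniz_quotientSeminorm {A : Type*} [CStarAlgebra A]
    {B : NonUnitalStarSubalgebra ℂ A} (hB : IsNondegenerate B) :
    IsStronglyLeibniz (quotientSeminorm B) :=
  isStronglyLeibniz_of_forall_exists fun a ↦ by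
    obtain ⟨D, _, π, U, hU, hUB, ha⟩ := exists_commutatorSeminorm_eq_quotientSeminorm hB a
    have h_le := commutatorSeminorm_le_quotientSeminorm hU hUB
    have h_one : commutatorSeminorm π U 1 = 0 :=
      le_antisymm ((h_le 1).trans_eq (quotientSeminorm_eq_zero_of_mem_closure hB.one_mem_closure))
        (apply_nonneg _ _)
    exact ⟨commutatorSeminorm π U, isStronglyLeibniz_commutatorSeminorm π
      (commutatorSeminorm_eq_zero_iff.1 h_one), h_le, ha⟩

end Main

theorem corollary3p5_general :
    (∀ (A : Type*) [NonUnitalCStarAlgebra A] (B : NonUnitalStarSubalgebra ℂ A),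
      IsNondegenerate B →
        IsGreatest
          {M : Seminorm ℂ A | IsLeibniz M ∧ (∀ b ∈ B, M b = 0) ∧ ∀ a : A, M a ≤ ‖a‖}
          (quotientSeminorm B)) ∧
    (∀ (A : Type*) [CStarAlgebra A] (B : NonUnitalStarSubalgebra ℂ A),
      IsNondegenerate B →
        IsGreatest
          {M : Seminorm ℂ A | IsStronglyLeibniz M ∧ (∀ b ∈ B, M b = 0) ∧ ∀ a : A, M a ≤ ‖a‖}
          (quotientSeminorm B)) := by
  refine ⟨fun A _ B hB ↦ ⟨⟨isLeibniz_quotientSeminorm hB, fun b hb ↦ ?_,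
      quotientSeminorm_le_norm⟩, fun M hM ↦ le_quotientSeminorm hM.2.1 hM.2.2⟩,
    fun A _ B hB ↦ ⟨⟨isStronglyLeibniz_quotientSeminorm hB, fun b hb ↦ ?_,
      quotientSeminorm_le_norm⟩, fun M hM ↦ le_quotientSeminorm hM.2.1 hM.2.2⟩⟩ <;>
  exact quotientSeminorm_eq_zero_of_mem_closure (subset_closure hb)

theorem corollary3p5 :
    (∀ (A : Type*) [NonUnitalCStarAlgebra A] (B : NonUnitalStarSubalgebra ℂ A),
      IsClosed (B : Set A) → ContainsBoundedApproximateIdentity B →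
        IsGreatest
          {M : Seminorm ℂ A | IsLeibniz M ∧ (∀ b ∈ B, M b = 0) ∧ ∀ a : A, M a ≤ ‖a‖}
          (quotientSeminorm B)) ∧
    (∀ (A : Type*) [CStarAlgebra A] (B : NonUnitalStarSubalgebra ℂ A),
      IsClosed (B : Set A) → (1 : A) ∈ B →
        IsGreatest
          {M : Seminorm ℂ A | IsStronglyLeibniz M ∧ (∀ b ∈ B, M b = 0) ∧ ∀ a : A, M a ≤ ‖a‖}
          (quotientSeminorm B)) := by
  exact corollary3p5_general.imp (fun h A _ B _ hB ↦ h A B hB.isNondegenerate)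
    (fun h A _ B _ hB ↦ h A B (isNondegenerate_of_one_mem hB))
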